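/- Let $d\ge 1$ and $n\ge 0$ be integers, let $V=\mathbb{C}^n$ with standard basis $(y_1,\dots,y_n)$ and dual basis $(x_1,\dots,x_n)$, and let $W=G(d,1,n)\subset \mathrm{GL}_n(\mathbb{C})$ be the group of monomial matrices whose nonzero entries are $d$-th roots of unity. Let $\mathrm{Ref}(W)$ be the set of pseudo-reflections of $W$ (the $s\in W$ with $s-\mathrm{id}_V$ of rank $1$), for each $s\in\mathrm{Ref}(W)$ choose $\alpha_s\in V^*$ with $\ker\alpha_s=\ker(s-\mathrm{id}_V)$, and let $\mathbf{c}\colon\mathrm{Ref}(W)\to\mathbb{C}$, $s\mapsto c_s$, be a function invariant under conjugation by $W$. For a field $K\supseteq\mathbb{C}$, a $K$-subalgebra $B\subseteq KW$ and a simple $B$-module $L$, put \[ \gamma_L^{B}=\sum_{\chi\in\mathrm{Irr}(W)}\bigl[\mathrm{Res}_{B}(K\otimes_{\mathbb{C}}V_\chi):L\bigr]\,\chi , \] where $\mathrm{Irr}(W)$ is the set of irreducible complex characters of $W$, $V_\chi$ is a complex representation affording $\chi$, and $[X:L]$ is the multiplicity of $L$ as a composition factor of $X$. The characters $\gamma_L^{B}$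 are called the cellular characters for $B$. (i) For $y\in V$ let \[ \mathcal{D}_y=\sum_{s\in\mathrm{Ref}(W)}c_s\det(s)\,\frac{\langle y,\alpha_s\rangle}{\alpha_s}\,s , \] an element of the group algebra of $W$ with coefficients in $\mathbb{C}[V^{\mathrm{reg}}]\subset\mathbb{C}(V)$, where $V^{\mathrm{reg}}$ is the complement in $V$ of the reflecting hyperplanes of $W$. The Gaudin algebra $\mathrm{Gau}_{\mathbf{c}}(W)$ is the $\mathbb{C}[V]$-algebra generated by the $\mathcal{D}_y$, $y\in V$. The Calogero–Moser $\mathbf{c}$-cellular characters of $W$ are the cellular characters for $B=\mathbb{C}(V)\,\mathrm{Gau}_{\mathbf{c}}(W)\subseteq\mathbb{C}(V)W$ (with $K=\mathbb{C}(V)$). (ii) For $0\le k\le n$ identify $G(d,1,k)$ with the subgroup of $G(d,1,n)$ fixing $y_{k+1},\dots,y_n$, and let $\mathbf{eu}_{\mathbf{c},k}=\sum_{s\in\mathrm{Ref}(G(d,1,k))}c_s\det(s)\,s\in\mathbb{C}W$. For $1\le k\le n$ let $J_k=\mathbf{eu}_{\mathbf{c},k}-\mathbf{eu}_{\mathbf{c},k-1}$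 be the Jucys–Murphy elements, and let $\mathbf{JM}_{\mathbf{c}}(d,n)$ be the subalgebra of $\mathbb{C}W$ generated by $J_1,\dots,J_n$. Then every cellular character for $\mathbf{JM}_{\mathbf{c}}(d,n)$ (with $K=\mathbb{C}$) is a finite sum, repetitions allowed, of Calogero–Moser $\mathbf{c}$-cellular characters of $G(d,1,n)$. -/

import Mathlib

open scoped TensorProduct

noncomputable section

namespace CalogeroMoser

/-! ### Jordan–Hölder multiplicities -/

/-- The number of successive quotients of the series of submodules `s` isomorphic to `L`. -/
def factorCount {B X : Type*} [Ring B] [AddCommGroup X] [Module B X]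
    (L : Type*) [AddCommGroup L] [Module B L] (s : CompositionSeries (Submodule B X)) : ℕ :=
  Nat.card {i : Fin s.length //
    Nonempty ((s i.succ ⧸ (s i.castSucc).comap (s i.succ).subtype) ≃ₗ[B] L)}

/-- Independence of the composition series (Jordan–Hölder). -/
theorem factorCount_eq {B X : Type*} [Ring B] [AddCommGroup X] [Module B X]
    (L : Type*) [AddCommGroup L] [Module B L] (s t : CompositionSeries (Submodule B X))
    (hb : s.head = t.head) (ht : s.last = t.last) : factorCount L s = factorCount L t := by
  obtain ⟨f, hf⟩ := CompositionSeries.jordan_holder s t hb ht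
  refine Nat.card_congr (f.subtypeEquiv fun i => ?_)
  have e := (hf i).linearEquiv
  exact ⟨fun ⟨g⟩ => ⟨e.symm.trans g⟩, fun ⟨g⟩ => ⟨e.trans g⟩⟩

open Classical in
/-- The multiplicity `[X : L]` of a simple `B`-module `L` in a `B`-module `X` of finite length:
the number of factors isomorphic to `L` in a composition series of `X`
(and `0` if `X` has no composition series). -/
def mult (B X L : Type*) [Ring B] [AddCommGroup X] [Module B X]
    [AddCommGroup L] [Module B L] : ℕ :=
  if h : ∃ s : CompositionSeries (Submodule B X), s.head = ⊥ ∧ s.last = ⊤ then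
    factorCount L h.choose
  else 0

theorem mult_eq {B X L : Type*} [Ring B] [AddCommGroup X] [Module B X]
    [AddCommGroup L] [Module B L] (s : CompositionSeries (Submodule B X))
    (hb : s.head = ⊥) (ht : s.last = ⊤) : mult B X L = factorCount L s := by
  have h : ∃ s : CompositionSeries (Submodule B X), s.head = ⊥ ∧ s.last = ⊤ := ⟨s, hb, ht⟩
  rw [mult, dif_pos h]
  exact factorCount_eq L _ _ (h.choose_spec.1.trans hb.symm) (h.choose_spec.2.trans ht.symm)

/-! ### Irreducible complex characters -/

/-- `Irr(G)`: the set of characters of irreducible complex (matrix) representations of `G`. -/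
def Irr (G : Type) [Group G] : Set (G → ℂ) :=
  {χ | ∃ (m : ℕ) (ρ : Representation ℂ G (Fin m → ℂ)), ρ.IsIrreducible ∧ ρ.character = χ}

/-- The dimension of the chosen representation affording `χ`. -/
def irrDim {G : Type} [Group G] (χ : Irr G) : ℕ := χ.2.choose

/-- A representation `V_χ` affording the character `χ`. -/
def irrRep {G : Type} [Group G] (χ : Irr G) : Representation ℂ G (Fin (irrDim χ) → ℂ) :=
  χ.2.choose_spec.choose

theorem irrRep_isIrreducible {G : Type} [Group G] (χ : Irr G) : (irrRep χ).IsIrreducible :=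
  χ.2.choose_spec.choose_spec.1

theorem irrRep_character {G : Type} [Group G] (χ : Irr G) : (irrRep χ).character = χ :=
  χ.2.choose_spec.choose_spec.2

/-- A finite group has finitely many irreducible complex characters. -/
instance irrFinite (G : Type) [Group G] [Finite G] : Finite (Irr G) := by
  classical
  have : Fintype G := Fintype.ofFinite G
  have hne : (Nat.card G : ℂ) ≠ 0 := Nat.cast_ne_zero.mpr Nat.card_pos.ne'
  have : Invertible (Nat.card G : ℂ) := invertibleOfNonzero hne
  have key : ∀ χ ψ : Irr G,
      (Nat.card G : ℂ)⁻¹ * ∑ g : G, (χ : G → ℂ) g * (ψ : G → ℂ) g⁻¹ = if χ = ψ then 1 else 0 := by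
    intro χ ψ
    have := irrRep_isIrreducible χ
    have := irrRep_isIrreducible ψ
    have h := Representation.char_orthonormal (irrRep χ) (irrRep ψ)
    rw [irrRep_character χ, irrRep_character ψ] at h
    rw [h]
    by_cases e : χ = ψ
    · subst e
      rw [if_pos rfl, if_pos ⟨Representation.Equiv.refl _⟩]
    · rw [if_neg e]
      by_cases hn : Nonempty (Representation.Equiv (irrRep ψ) (irrRep χ))
      · obtain ⟨φ⟩ := hn
        refine absurd (Subtype.ext ?_) e
        rw [← irrRep_character χ, ← irrRep_character ψ]
        exact (Representation.char_iso φ).symm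
      · rw [if_neg hn]
  have li : LinearIndependent ℂ (fun χ : Irr G => (χ : G → ℂ)) := by
    rw [linearIndependent_iff']
    intro s a ha ψ hψ
    have h : (Nat.card G : ℂ)⁻¹ * ∑ g : G, (∑ χ ∈ s, a χ • (χ : G → ℂ)) g * (ψ : G → ℂ) g⁻¹
        = a ψ := by
      calc _ = ∑ χ ∈ s, a χ * ((Nat.card G : ℂ)⁻¹ *
              ∑ g : G, (χ : G → ℂ) g * (ψ : G → ℂ) g⁻¹) := by
            simp only [Finset.sum_apply, Pi.smul_apply, smul_eq_mul, Finset.sum_mul,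
              Finset.mul_sum]
            rw [Finset.sum_comm]
            refine Finset.sum_congr rfl fun _ _ => Finset.sum_congr rfl fun _ _ => ?_
            ring
        _ = a ψ := by
            simp only [key, mul_ite, mul_one, mul_zero]
            rw [Finset.sum_ite_eq' s ψ a, if_pos hψ]
    rw [ha] at h
    simpa using h.symm
  exact li.finite

/-! ### Cellular characters of a subalgebra of a group algebra -/

/-- Extension of scalars of a complex representation to a field `K ⊇ ℂ`. -/
def extendScalars (K : Type*) [Field K] [Algebra ℂ K] {G V : Type*} [Group G]
    [AddCommGroup V] [Module ℂ V] (ρ : Representation ℂ G V) : Representation K G (K ⊗[ℂ] V) where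
  toFun g := (ρ g).baseChange K
  map_one' := by rw [map_one]; exact LinearMap.baseChange_one ..
  map_mul' g h := by rw [map_mul]; exact LinearMap.baseChange_mul ..

/-- For a field `K ⊇ ℂ`, a `K`-subalgebra `B` of the group algebra `K G` and a simple
`B`-module `L`, the class function
`γ_L = ∑_{χ ∈ Irr(G)} [Res_B (K ⊗ V_χ) : L] χ`. -/
def cellularCharacter {K : Type} [Field K] [Algebra ℂ K] {G : Type} [Group G]
    (B : Subalgebra K (MonoidAlgebra K G)) (L : Type) [AddCommGroup L] [Module B L] : G → ℂ :=
  ∑ᶠ χ : Irr G, (mult B (extendScalars K (irrRep χ)).asModule L) • (χ : G → ℂ)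

/-- `γ` is a cellular character for `B`: it is `γ_L` for some simple `B`-module `L`. -/
def IsCellularCharacter {K : Type} [Field K] [Algebra ℂ K] {G : Type} [Group G]
    (B : Subalgebra K (MonoidAlgebra K G)) (γ : G → ℂ) : Prop :=
  ∃ (L : Type) (_ : AddCommGroup L) (_ : Module B L),
    IsSimpleModule B L ∧ γ = cellularCharacter B L

/-! ### Reflections and the Gaudin algebra -/

/-- The matrix of an element of `W ⊆ GL_n(ℂ)`, acting on `V = ℂⁿ` by `Matrix.mulVec`. -/
def toMatrix {n : ℕ} {W : Subgroup (GL (Fin n) ℂ)} (w : W) : Matrix (Fin n) (Fin n) ℂ :=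
  ((w : GL (Fin n) ℂ) : Matrix (Fin n) (Fin n) ℂ)

/-- `Ref(W)`: the pseudo-reflections in `W`, i.e. the `s` with `s - id_V` of rank one. -/
def Ref {n : ℕ} (W : Subgroup (GL (Fin n) ℂ)) : Set W :=
  {s | (toMatrix s - 1).rank = 1}

/-- `α` chooses, for each reflection `s`, a linear form `α_s` with `ker α_s = ker (s - id_V)`. -/
def IsRootChoice {n : ℕ} (W : Subgroup (GL (Fin n) ℂ))
    (α : Ref W → Module.Dual ℂ (Fin n → ℂ)) : Prop :=
  ∀ s : Ref W, LinearMap.ker (α s) = LinearMap.ker (Matrix.mulVecLin (toMatrix s.1 - 1))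

/-- `c : Ref(W) → ℂ` is invariant under conjugation by `W`. -/
def IsConjInvariant {n : ℕ} {W : Subgroup (GL (Fin n) ℂ)} (c : Ref W → ℂ) : Prop :=
  ∀ s t : Ref W, IsConj (s : W) (t : W) → c s = c t

/-- `ℂ[V] = ℂ[x₁, …, xₙ]`. -/
abbrev PolyV (n : ℕ) : Type := MvPolynomial (Fin n) ℂ

/-- `ℂ(V)`, the fraction field of `ℂ[V]`. -/
abbrev RatV (n : ℕ) : Type := FractionRing (PolyV n)

/-- A linear form on `V`, seen as an element of `ℂ[V]`. -/
def linearFormToPoly {n : ℕ} (a : Module.Dual ℂ (Fin n → ℂ)) : PolyV n :=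
  ∑ i, MvPolynomial.C (a (Pi.single i 1)) * MvPolynomial.X i

/-- `𝒟_y = ∑_{s ∈ Ref(W)} c_s det(s) (⟨y, α_s⟩ / α_s) s`. Its coefficients lie in
`ℂ[V^reg] ⊆ ℂ(V)`; we regard it as an element of the group algebra of `W` over `ℂ(V)`. -/
def gaudinOperator {n : ℕ} (W : Subgroup (GL (Fin n) ℂ)) (c : Ref W → ℂ)
    (α : Ref W → Module.Dual ℂ (Fin n → ℂ)) (y : Fin n → ℂ) : MonoidAlgebra (RatV n) W :=
  ∑ᶠ s : Ref W, MonoidAlgebra.single (s : W)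
    (algebraMap (PolyV n) (RatV n)
        (MvPolynomial.C (c s * (toMatrix s.1).det * α s y)) /
      algebraMap (PolyV n) (RatV n) (linearFormToPoly (α s)))

/-- The Gaudin algebra: the `ℂ[V]`-subalgebra generated by the `𝒟_y`, `y ∈ V`. -/
def gaudinAlgebra {n : ℕ} (W : Subgroup (GL (Fin n) ℂ)) (c : Ref W → ℂ)
    (α : Ref W → Module.Dual ℂ (Fin n → ℂ)) : Subalgebra (PolyV n) (MonoidAlgebra (RatV n) W) :=
  Algebra.adjoin (PolyV n) (Set.range (gaudinOperator W c α))

/-- `ℂ(V) Gau_c(W)`, the `ℂ(V)`-subalgebra of `ℂ(V) W` generated by the Gaudin algebra. -/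
def gaudinAlgebraRat {n : ℕ} (W : Subgroup (GL (Fin n) ℂ)) (c : Ref W → ℂ)
    (α : Ref W → Module.Dual ℂ (Fin n → ℂ)) : Subalgebra (RatV n) (MonoidAlgebra (RatV n) W) :=
  Algebra.adjoin (RatV n) (gaudinAlgebra W c α : Set (MonoidAlgebra (RatV n) W))

/-- The Calogero–Moser `c`-cellular characters of `W`. -/
def IsCMCellularCharacter {n : ℕ} (W : Subgroup (GL (Fin n) ℂ)) (c : Ref W → ℂ)
    (α : Ref W → Module.Dual ℂ (Fin n → ℂ)) (γ : W → ℂ) : Prop :=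
  IsCellularCharacter (gaudinAlgebraRat W c α) γ

/-! ### The group `G(d,1,n)` and its Jucys–Murphy elements -/

/-- The monomial matrix with entry `a j` at position `(σ j, j)`. -/
def monomialMatrix {n : ℕ} (σ : Equiv.Perm (Fin n)) (a : Fin n → ℂˣ) :
    Matrix (Fin n) (Fin n) ℂ :=
  Matrix.of fun i j => if i = σ j then (a j : ℂ) else 0

theorem monomialMatrix_one {n : ℕ} : monomialMatrix (1 : Equiv.Perm (Fin n)) 1 = 1 := by
  ext i j
  change (if i = j then (1 : ℂ) else 0) = _
  rw [Matrix.one_apply]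

theorem monomialMatrix_mul {n : ℕ} (σ τ : Equiv.Perm (Fin n)) (a b : Fin n → ℂˣ) :
    monomialMatrix σ a * monomialMatrix τ b =
      monomialMatrix (σ * τ) (fun j => a (τ j) * b j) := by
  ext i j
  simp only [monomialMatrix, Matrix.mul_apply, Matrix.of_apply, Units.val_mul]
  rw [Finset.sum_eq_single (τ j)]
  · rw [if_pos rfl]
    by_cases h : i = (σ * τ) j
    · rw [if_pos h, if_pos (show i = σ (τ j) from h)]
    · rw [if_neg h, if_neg (show ¬i = σ (τ j) from h), zero_mul]
  · intro x _ hx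
    rw [if_neg hx, mul_zero]
  · intro h
    exact absurd (Finset.mem_univ _) h

/-- `G(d,1,n)`: the group of monomial `n × n` matrices whose nonzero entries are
`d`-th roots of unity. -/
def G (d n : ℕ) : Subgroup (GL (Fin n) ℂ) where
  carrier := {g | ∃ (σ : Equiv.Perm (Fin n)) (a : Fin n → ℂˣ),
    (∀ i, a i ^ d = 1) ∧ (g : Matrix (Fin n) (Fin n) ℂ) = monomialMatrix σ a}
  one_mem' := ⟨1, 1, by simp, by simp [monomialMatrix_one]⟩
  mul_mem' := by
    rintro g h ⟨σ, a, ha, hg⟩ ⟨τ, b, hb, hh⟩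
    refine ⟨σ * τ, fun j => a (τ j) * b j, fun i => by simp [mul_pow, ha, hb], ?_⟩
    rw [Units.val_mul, hg, hh, monomialMatrix_mul]
  inv_mem' := by
    rintro g ⟨σ, a, ha, hg⟩
    refine ⟨σ⁻¹, fun j => (a (σ⁻¹ j))⁻¹, fun i => by simp [ha], ?_⟩
    have h : (g : Matrix (Fin n) (Fin n) ℂ) *
        monomialMatrix σ⁻¹ (fun j => (a (σ⁻¹ j))⁻¹) = 1 := by
      rw [hg, monomialMatrix_mul, ← monomialMatrix_one]
      congr 1
      · simp
      · funext j; simp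
    exact Units.inv_eq_of_mul_eq_one_right h

theorem G_finite (d n : ℕ) (hd : 0 < d) : Finite (G d n) := by
  have : NeZero d := ⟨hd.ne'⟩
  let f : Equiv.Perm (Fin n) × (Fin n → rootsOfUnity d ℂ) → Matrix (Fin n) (Fin n) ℂ :=
    fun p => monomialMatrix p.1 fun j => (p.2 j : ℂˣ)
  have hr : (Set.range f).Finite := Set.finite_range f
  have : Finite (Set.range f) := hr
  refine Finite.of_injective
    (fun w : G d n => (⟨toMatrix w, by
      obtain ⟨σ, a, ha, hg⟩ := w.2
      exact ⟨(σ, fun j => ⟨a j, (mem_rootsOfUnity d _).2 (ha j)⟩), hg.symm⟩⟩ : Set.range f)) ?_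
  intro w w' h
  exact Subtype.ext (Units.ext (congrArg Subtype.val h))

/-- `G(d,1,k)` inside `G(d,1,n)` (`k ≤ n`): the elements acting on the first `k` coordinates,
i.e. fixing the basis vectors `y_{k+1}, …, y_n`. -/
def subG (d n k : ℕ) : Set (G d n) :=
  {w | ∀ j : Fin n, k ≤ (j : ℕ) → (toMatrix w).mulVec (Pi.single j 1) = Pi.single j 1}

/-- The Euler element `eu_{c,k} = ∑_{s ∈ Ref(G(d,1,k))} c_s det(s) s` of `G(d,1,k)`,
in the group algebra of `G(d,1,n)`. -/
def euler {d n : ℕ} (c : Ref (G d n) → ℂ) (k : ℕ) : MonoidAlgebra ℂ (G d n) :=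
  ∑ᶠ (s : Ref (G d n)) (_ : (s : G d n) ∈ subG d n k),
    MonoidAlgebra.single (s : G d n) (c s * (toMatrix s.1).det)

/-- The Jucys–Murphy element `eu_{c,k+1} - eu_{c,k}`; the index `k : Fin n` starts at `0`. -/
def jucysMurphy {d n : ℕ} (c : Ref (G d n) → ℂ) (k : Fin n) : MonoidAlgebra ℂ (G d n) :=
  euler c ((k : ℕ) + 1) - euler c (k : ℕ)

/-- `JM_c(d,n)`, the subalgebra of `ℂG(d,1,n)` generated by the Jucys–Murphy elements. -/
def jmAlgebra {d n : ℕ} (c : Ref (G d n) → ℂ) : Subalgebra ℂ (MonoidAlgebra ℂ (G d n)) :=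
  Algebra.adjoin ℂ (Set.range (jucysMurphy c))

end CalogeroMoser

end

/-!
Choose a valuation of `ℂ(V)`, trivial on `ℂ`, for which `x_1, …, x_n` have strictly increasing
values, and let `W_k` be the subgroup fixing `y_{k+1}, …, y_n`. If `x_M` is the last coordinate
occurring in `α_s`, it dominates `α_s`, so that `x_k ⟨y_k, α_s⟩ / α_s` reduces to `1` if `k = M` and
to `0` otherwise. As the reflection `s` lies in `W_k` exactly when `M ≤ k`, the operator
`x_k 𝒟_{y_k}` reduces to `J_k`.

So every element of the Jucys–Murphy algebra `A` is the reduction of an integral element of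
`B = ℂ(V) Gau_c(W)`. The algebra `A` is commutative, so for a simple `A`-module `L` some `a ∈ A`
acts by `1` on the composition factors isomorphic to `L` and by `0` on the others: the multiplicity
of `L` in `V_χ` is the multiplicity of the root `1` of the characteristic polynomial of `a` on
`V_χ`. Lift `a` to `b ∈ B`. The characteristic polynomial of `b` on `V_χ` is the product of those on
the composition factors for `B`; each of these has integral coefficients, since a valuation ring is
integrally closed, and its reduction has `1` as a root with a multiplicity depending only on the
isomorphism class of the factor. These multiplicities are the coefficients of the sum.
-/

noncomputable section

namespace CalogeroMoser

open Polynomial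

section Charpoly

variable {k V : Type*} [CommRing k] [AddCommGroup V] [Module k V] [Module.Free k V]
  [Module.Finite k V]

theorem charpoly_eq_charpoly_restrict_mul_charpoly_mapQ (p : Submodule k V) [Module.Free k p]
    [Module.Finite k p] [Module.Free k (V ⧸ p)] (f : V →ₗ[k] V) (hp : p ≤ p.comap f) :
    f.charpoly = (f.restrict hp).charpoly * (p.mapQ p f hp).charpoly := by
  classical
  let b := Module.Free.chooseBasis k p
  let b' := Module.Free.chooseBasis k (V ⧸ p)
  let M := LinearMap.toMatrix (b.sumQuot b') (b.sumQuot b') f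
  have h₁₁ : M.toBlocks₁₁ = LinearMap.toMatrix b b (f.restrict hp) := by
    ext i j
    have hj : f (b j) ∈ p := hp (b j).2
    simp [M, Matrix.toBlocks₁₁, LinearMap.toMatrix_apply, hj, LinearMap.restrict_apply]
  have h₂₁ : M.toBlocks₂₁ = 0 := by
    ext i j
    have hj : p.mkQ (f (b j)) = 0 := (Submodule.Quotient.mk_eq_zero p).2 (hp (b j).2)
    simp only [M, Matrix.toBlocks₂₁, LinearMap.toMatrix_apply, Matrix.of_apply,
      Module.Basis.sumQuot_inl, Module.Basis.sumQuot_repr_inr, hj, map_zero,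
      Finsupp.coe_zero, Pi.zero_apply, Matrix.zero_apply]
  have h₂₂ : M.toBlocks₂₂ = LinearMap.toMatrix b' b' (p.mapQ p f hp) := by
    ext i j
    rw [LinearMap.toMatrix_apply, ← b.sumQuot_inr b' j]
    simp only [M, Matrix.toBlocks₂₂, LinearMap.toMatrix_apply, Matrix.of_apply,
      Module.Basis.sumQuot_repr_inr, Submodule.mkQ_apply, Submodule.mapQ_apply]
  rw [← LinearMap.charpoly_toMatrix f (b.sumQuot b'), ← LinearMap.charpoly_toMatrix _ b,
    ← LinearMap.charpoly_toMatrix _ b', ← h₁₁, ← h₂₂, ← Matrix.charpoly_fromBlocks_zero₂₁,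
    ← h₂₁, Matrix.fromBlocks_toBlocks]

end Charpoly

/-- The characteristic polynomial over `k` of the action of `f : R` on the `R`-module `Y`. -/
def actionCharpoly (k : Type*) {R : Type*} [Field k] [Ring R] [Algebra k R] (f : R)
    (Y : Type*) [AddCommGroup Y] [Module k Y] [Module R Y] [IsScalarTower k R Y]
    [Module.Finite k Y] : k[X] :=
  (Algebra.lsmul k k Y f).charpoly

section Series

variable {k R X : Type*} [Field k] [Ring R] [Algebra k R] [AddCommGroup X] [Module k X]
  [Module R X] [IsScalarTower k R X] [Module.Finite k X]

theorem actionCharpoly_monic (f : R) : (actionCharpoly k f X).Monic :=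
  LinearMap.charpoly_monic _

theorem actionCharpoly_congr {Y : Type*} [AddCommGroup Y] [Module k Y] [Module R Y]
    [IsScalarTower k R Y] [Module.Finite k Y] (e : X ≃ₗ[R] Y) (f : R) :
    actionCharpoly k f X = actionCharpoly k f Y := by
  rw [actionCharpoly, actionCharpoly,
    ← LinearEquiv.charpoly_conj (e.restrictScalars k) (Algebra.lsmul k k X f)]
  congr 1
  ext y
  simp

theorem actionCharpoly_of_subsingleton [Subsingleton X] (f : R) : actionCharpoly k f X = 1 := by
  refine (actionCharpoly_monic f).natDegree_eq_zero.1 ?_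
  rw [actionCharpoly, LinearMap.charpoly_natDegree, Module.finrank_zero_of_subsingleton]

instance finite_submodule (N : Submodule R X) : Module.Finite k N :=
  inferInstanceAs (Module.Finite k (N.restrictScalars k))

instance finite_quotient (N : Submodule R X) : Module.Finite k (X ⧸ N) :=
  Module.Finite.of_surjective (N.mkQ.restrictScalars k) N.mkQ_surjective

theorem actionCharpoly_eq_mul_quotient (N : Submodule R X) (f : R) :
    actionCharpoly k f X = actionCharpoly k f N * actionCharpoly k f (X ⧸ N) :=
  charpoly_eq_charpoly_restrict_mul_charpoly_mapQ (N.restrictScalars k)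
    (Algebra.lsmul k k X f) fun _ hx => N.smul_mem f hx

theorem actionCharpoly_eq_mul_of_le {N M : Submodule R X} (h : N ≤ M) (f : R) :
    actionCharpoly k f M =
      actionCharpoly k f N * actionCharpoly k f (M ⧸ N.comap M.subtype) := by
  rw [actionCharpoly_eq_mul_quotient (N.comap M.subtype) f,
    actionCharpoly_congr (Submodule.comapSubtypeEquivOfLe h)]

/-- The `i`-th successive quotient of a composition series of submodules, in the form in which
it is counted by `factorCount`. -/
abbrev seriesFactor (s : CompositionSeries (Submodule R X)) (i : Fin s.length) : Type _ :=
  s i.succ ⧸ (s i.castSucc).comap (s i.succ).subtype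

theorem isSimpleModule_seriesFactor (s : CompositionSeries (Submodule R X)) (i : Fin s.length) :
    IsSimpleModule R (seriesFactor s i) :=
  covBy_iff_quot_is_simple (s.step i).le |>.1 (s.step i)

theorem actionCharpoly_eq_prod_seriesFactor (s : CompositionSeries (Submodule R X))
    (hb : s.head = ⊥) (ht : s.last = ⊤) (f : R) :
    actionCharpoly k f X = ∏ i, actionCharpoly k f (seriesFactor s i) := by
  let p : Fin s.length → k[X] := fun i => actionCharpoly k f (seriesFactor s i)
  have hpartial : ∀ j, actionCharpoly k f (s j) = Fin.partialProd p j := by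
    intro j
    induction j using Fin.induction with
    | zero =>
      have : Subsingleton (s 0) := by
        rw [show s 0 = ⊥ from hb]; infer_instance
      rw [actionCharpoly_of_subsingleton, Fin.partialProd_zero]
    | succ j ih => rw [actionCharpoly_eq_mul_of_le (s.step j).le, ih, Fin.partialProd_succ]
  have e : s (Fin.last _) ≃ₗ[R] X :=
    (LinearEquiv.ofEq _ _ (show s (Fin.last _) = ⊤ from ht)).trans Submodule.topEquiv
  rw [← actionCharpoly_congr e, hpartial, Fin.partialProd, Fin.val_last,
    List.take_of_length_le (List.length_ofFn).le, List.prod_ofFn]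

end Series

theorem exists_compositionSeries (k R X : Type*) [Field k] [Ring R] [Algebra k R]
    [AddCommGroup X] [Module k X] [Module R X] [IsScalarTower k R X] [Module.Finite k X] :
    ∃ s : CompositionSeries (Submodule R X), s.head = ⊥ ∧ s.last = ⊤ := by
  have : IsNoetherian R X := isNoetherian_of_tower k inferInstance
  have : IsArtinian R X := isArtinian_of_tower k inferInstance
  exact exists_compositionSeries_of_isNoetherian_isArtinian R X

open Classical in
theorem mult_eq_card_seriesFactor {B X : Type*} (L : Type*) [Ring B] [AddCommGroup X] [Module B X]
    [AddCommGroup L] [Module B L] (s : CompositionSeries (Submodule B X))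
    (hb : s.head = ⊥) (ht : s.last = ⊤) :
    mult B X L = Finset.card {i | Nonempty (seriesFactor s i ≃ₗ[B] L)} := by
  rw [mult_eq s hb ht, factorCount, Nat.card_eq_fintype_card, Fintype.card_subtype]

theorem rootMultiplicity_prod {R ι : Type*} [CommRing R] [IsDomain R] (s : Finset ι) (f : ι → R[X])
    (hf : ∀ i ∈ s, (f i).Monic) (x : R) :
    (∏ i ∈ s, f i).rootMultiplicity x = ∑ i ∈ s, (f i).rootMultiplicity x := by
  classical
  have hprod : ∏ i ∈ s, f i ≠ 0 := (monic_prod_of_monic s f hf).ne_zero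
  simp only [← count_roots, roots_prod f s hprod, Multiset.count_bind]
  rfl

theorem nonempty_linearEquiv_iff_annihilator_eq {R S T : Type*} [CommRing R] [AddCommGroup S]
    [Module R S] [AddCommGroup T] [Module R T] [IsSimpleModule R S] [IsSimpleModule R T] :
    Nonempty (S ≃ₗ[R] T) ↔ Module.annihilator R S = Module.annihilator R T := by
  refine ⟨fun ⟨e⟩ => e.annihilator_eq, fun h => ?_⟩
  obtain ⟨I, -, ⟨e⟩⟩ := isSimpleModule_iff_quot_maximal.1 ‹IsSimpleModule R S›
  obtain ⟨J, -, ⟨e'⟩⟩ := isSimpleModule_iff_quot_maximal.1 ‹IsSimpleModule R T›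
  rw [e.annihilator_eq, e'.annihilator_eq, Ideal.annihilator_quotient,
    Ideal.annihilator_quotient] at h
  subst h
  exact ⟨e.trans e'.symm⟩

open Classical in
theorem exists_smul_eq_ite {R ι : Type*} [CommRing R] [Finite ι] (S : ι → Type*)
    [∀ i, AddCommGroup (S i)] [∀ i, Module R (S i)] [∀ i, IsSimpleModule R (S i)]
    (T : Type*) [AddCommGroup T] [Module R T] [IsSimpleModule R T] :
    ∃ f : R, ∀ i (x : S i), f • x = if Nonempty (S i ≃ₗ[R] T) then x else 0 := by
  let 𝔪 : Set.range (fun i => Module.annihilator R (S i)) → Ideal R := Subtype.val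
  have h𝔪 : ∀ j, (𝔪 j).IsMaximal := by
    rintro ⟨_, i, rfl⟩
    exact IsSimpleModule.annihilator_isMaximal
  obtain ⟨f, hf⟩ := Ideal.exists_forall_sub_mem_ideal (I := 𝔪)
    (fun j j' hj => Ideal.isCoprime_of_isMaximal (Subtype.coe_ne_coe.2 hj))
    fun j => if 𝔪 j = Module.annihilator R T then 1 else 0
  refine ⟨f, fun i x => ?_⟩
  have hx := Module.mem_annihilator.1 (hf ⟨_, i, rfl⟩) x
  rw [sub_smul, sub_eq_zero] at hx
  simp only [hx, nonempty_linearEquiv_iff_annihilator_eq, 𝔪, ite_smul, one_smul, zero_smul]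

open Classical in
theorem exists_mult_eq_rootMultiplicity {k R I : Type*} [Field k] [IsAlgClosed k] [CommRing R]
    [Algebra k R] [Finite I] (X : I → Type*) [∀ χ, AddCommGroup (X χ)] [∀ χ, Module k (X χ)]
    [∀ χ, Module R (X χ)] [∀ χ, IsScalarTower k R (X χ)] [∀ χ, Module.Finite k (X χ)]
    (L : Type*) [AddCommGroup L] [Module R L] [IsSimpleModule R L] :
    ∃ f : R, ∀ χ, mult R (X χ) L = (actionCharpoly k f (X χ)).rootMultiplicity 1 := by
  choose s hb ht using fun χ => exists_compositionSeries k R (X χ)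
  have hsimple : ∀ p : Σ χ, Fin (s χ).length, IsSimpleModule R (seriesFactor (s p.1) p.2) :=
    fun p => isSimpleModule_seriesFactor (s p.1) p.2
  obtain ⟨f, hf⟩ := exists_smul_eq_ite (R := R)
    (fun p : Σ χ, Fin (s χ).length => seriesFactor (s p.1) p.2) L
  refine ⟨f, fun χ => ?_⟩
  rw [mult_eq_card_seriesFactor L (s χ) (hb χ) (ht χ), Finset.card_filter,
    actionCharpoly_eq_prod_seriesFactor (s χ) (hb χ) (ht χ),
    rootMultiplicity_prod _ _ fun i _ => actionCharpoly_monic f]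
  refine Finset.sum_congr rfl fun i _ => ?_
  have hS := hsimple ⟨χ, i⟩
  have hact := hf ⟨χ, i⟩
  split_ifs at hact ⊢
  · have h1 : Algebra.lsmul k k (seriesFactor (s χ) i) f = 1 := LinearMap.ext hact
    rw [actionCharpoly, h1, LinearMap.charpoly_one,
      IsSimpleModule.finrank_eq_one_of_isMulCommutative R (seriesFactor (s χ) i) k, pow_one,
      ← C_1, rootMultiplicity_X_sub_C_self]
  · have h0 : Algebra.lsmul k k (seriesFactor (s χ) i) f = 0 := LinearMap.ext hact
    rw [actionCharpoly, h0, LinearMap.charpoly_zero, rootMultiplicity_eq_zero (by simp [IsRoot])]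

section IsomorphismClasses

variable {B I : Type*} {Y : I → Type*} [Ring B] [∀ χ, AddCommGroup (Y χ)] [∀ χ, Module B (Y χ)]

/-- Isomorphism of the successive quotients of a family of composition series. -/
def factorSetoid (s : ∀ χ, CompositionSeries (Submodule B (Y χ))) :
    Setoid (Σ χ, Fin (s χ).length) where
  r p q := Nonempty (seriesFactor (s p.1) p.2 ≃ₗ[B] seriesFactor (s q.1) q.2)
  iseqv := ⟨fun _ => ⟨.refl _ _⟩, fun ⟨e⟩ => ⟨e.symm⟩, fun ⟨e⟩ ⟨e'⟩ => ⟨e.trans e'⟩⟩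

/-- The simple module representing an isomorphism class of successive quotients. -/
abbrev classFactor (s : ∀ χ, CompositionSeries (Submodule B (Y χ)))
    (C : Quotient (factorSetoid s)) : Type _ :=
  seriesFactor (s C.out.1) C.out.2

theorem mk_eq_iff_nonempty_linearEquiv (s : ∀ χ, CompositionSeries (Submodule B (Y χ)))
    (p : Σ χ, Fin (s χ).length) (C : Quotient (factorSetoid s)) :
    (⟦p⟧ : Quotient (factorSetoid s)) = C ↔
      Nonempty (seriesFactor (s p.1) p.2 ≃ₗ[B] classFactor s C) := by
  conv_lhs => rw [← Quotient.out_eq C, Quotient.eq]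
  rfl

open Classical in
theorem sum_seriesFactor_eq_sum_mult (s : ∀ χ, CompositionSeries (Submodule B (Y χ)))
    (hb : ∀ χ, (s χ).head = ⊥) (ht : ∀ χ, (s χ).last = ⊤) (D : (Σ χ, Fin (s χ).length) → ℕ)
    (hD : ∀ p q, factorSetoid s p q → D p = D q) (χ : I) [Fintype (Quotient (factorSetoid s))] :
    ∑ i, D ⟨χ, i⟩ =
      ∑ C : Quotient (factorSetoid s), mult B (Y χ) (classFactor s C) * D C.out := by
  rw [← Finset.sum_fiberwise _ fun i => (⟦⟨χ, i⟩⟧ : Quotient (factorSetoid s))]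
  refine Finset.sum_congr rfl fun C _ => ?_
  have hconst : ∀ i ∈ Finset.univ.filter fun i => (⟦⟨χ, i⟩⟧ : Quotient (factorSetoid s)) = C,
      D ⟨χ, i⟩ = D C.out := fun i hi =>
    hD _ _ ((mk_eq_iff_nonempty_linearEquiv s _ C).1 (Finset.mem_filter.1 hi).2)
  rw [Finset.sum_congr rfl hconst, Finset.sum_const, smul_eq_mul,
    mult_eq_card_seriesFactor _ (s χ) (hb χ) (ht χ)]
  simp only [mk_eq_iff_nonempty_linearEquiv]

end IsomorphismClasses

section Reduction

variable {O K κ : Type*} [CommRing O] [Field K] [Algebra O K] [IsFractionRing O K] [CommRing κ]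

theorem map_algebraMap_injective : Function.Injective (Polynomial.map (algebraMap O K)) :=
  map_injective _ (IsFractionRing.injective O K)

/-- The image in `κ[X]` under `π : O →+* κ` of a polynomial over the fraction field `K` of `O`
with coefficients in `O` (junk if the coefficients are not in `O`). -/
def reduction (π : O →+* κ) (q : K[X]) : κ[X] :=
  (Function.invFun (Polynomial.map (algebraMap O K)) q).map π

theorem reduction_map (π : O →+* κ) (p : O[X]) :
    reduction π (p.map (algebraMap O K)) = p.map π := by
  rw [reduction, Function.leftInverse_invFun map_algebraMap_injective]

variable [IsIntegrallyClosed O]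

theorem exists_monic_map_eq_of_dvd {P : O[X]} (hP : P.Monic) {q : K[X]} (hq : q.Monic)
    (h : q ∣ P.map (algebraMap O K)) : ∃ p : O[X], p.Monic ∧ p.map (algebraMap O K) = q := by
  obtain ⟨p, hp⟩ := IsIntegrallyClosed.eq_map_mul_C_of_dvd K hP h
  rw [hq.leadingCoeff, C_1, mul_one] at hp
  exact ⟨p, monic_of_injective (IsFractionRing.injective O K) (hp ▸ hq), hp⟩

theorem rootMultiplicity_map_eq_sum_reduction [IsDomain κ] (π : O →+* κ) {ι : Type*} (s : Finset ι)
    (q : ι → K[X]) (hq : ∀ i ∈ s, (q i).Monic) (P : O[X])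
    (hP : P.map (algebraMap O K) = ∏ i ∈ s, q i) (x : κ) :
    (P.map π).rootMultiplicity x = ∑ i ∈ s, (reduction π (q i)).rootMultiplicity x := by
  have hPmonic : P.Monic :=
    monic_of_injective (IsFractionRing.injective O K) (hP ▸ monic_prod_of_monic s q hq)
  choose! p hp hpq using fun i (hi : i ∈ s) =>
    exists_monic_map_eq_of_dvd hPmonic (hq i hi) (hP ▸ Finset.dvd_prod_of_mem q hi)
  have hprod : P = ∏ i ∈ s, p i := by
    refine map_algebraMap_injective (K := K) ?_
    rw [hP, Polynomial.map_prod, Finset.prod_congr rfl hpq]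
  rw [hprod, Polynomial.map_prod, rootMultiplicity_prod _ _ fun i hi => (hp i hi).map π]
  refine Finset.sum_congr rfl fun i hi => ?_
  rw [← hpq i hi, reduction_map]

theorem rootMultiplicity_map_eq_sum_mult [IsDomain κ] {R I : Type*} {Y : I → Type*} [Ring R]
    [Algebra K R] [∀ χ, AddCommGroup (Y χ)] [∀ χ, Module K (Y χ)] [∀ χ, Module R (Y χ)]
    [∀ χ, IsScalarTower K R (Y χ)] [∀ χ, Module.Finite K (Y χ)]
    (s : ∀ χ, CompositionSeries (Submodule R (Y χ))) (hb : ∀ χ, (s χ).head = ⊥)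
    (ht : ∀ χ, (s χ).last = ⊤) [Fintype (Quotient (factorSetoid s))] (π : O →+* κ) (b : R) (χ : I)
    (P : O[X]) (hP : P.map (algebraMap O K) = actionCharpoly K b (Y χ)) (x : κ) :
    (P.map π).rootMultiplicity x = ∑ C, mult R (Y χ) (classFactor s C) *
      (reduction π (actionCharpoly K b (classFactor s C))).rootMultiplicity x := by
  rw [actionCharpoly_eq_prod_seriesFactor (s χ) (hb χ) (ht χ)] at hP
  rw [rootMultiplicity_map_eq_sum_reduction π _ _ (fun i _ => actionCharpoly_monic b) P hP]
  exact sum_seriesFactor_eq_sum_mult s hb ht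
    (fun p => (reduction π (actionCharpoly K b (seriesFactor (s p.1) p.2))).rootMultiplicity x)
    (fun _ _ ⟨e⟩ => by rw [actionCharpoly_congr e]) χ

end Reduction

section RepMatrix

variable {k W ι : Type*} [CommRing k] [Monoid W] [Fintype ι] [DecidableEq ι]
  (ρ : Representation k W (ι → k))

/-- The action of `S[W]` on `S^ι` deduced by extension of scalars from a matrix representation
of `W` over `k`. -/
def repMatrix (S : Type*) [CommRing S] [Algebra k S] :
    MonoidAlgebra S W →ₐ[S] Matrix ι ι S :=
  MonoidAlgebra.lift S _ W
    ((RingHom.toMonoidHom (algebraMap k S).mapMatrix).comp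
      ((LinearMap.toMatrixAlgEquiv' : _ ≃ₐ[k] Matrix ι ι k).toMulEquiv.toMonoidHom.comp ρ))

theorem repMatrix_single (S : Type*) [CommRing S] [Algebra k S] (w : W) (a : S) :
    repMatrix ρ S (MonoidAlgebra.single w a) =
      a • (LinearMap.toMatrix' (ρ w)).map (algebraMap k S) :=
  MonoidAlgebra.lift_single ..

variable {S T : Type*} [CommRing S] [Algebra k S] [CommRing T] [Algebra k T]

theorem map_repMatrix (φ : S →ₐ[k] T) (z : MonoidAlgebra S W) :
    (repMatrix ρ S z).map φ = repMatrix ρ T (MonoidAlgebra.mapAlgHom W φ z) := by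
  induction z using MonoidAlgebra.induction with
  | zero => simp
  | single_add w a f _ _ ih =>
    rw [map_add, Matrix.map_add φ (map_add φ), ih, map_add, map_add, MonoidAlgebra.mapAlgHom_single,
      repMatrix_single, repMatrix_single]
    congr 1
    ext i j
    simp

theorem charpoly_map_repMatrix (φ : S →ₐ[k] T) (z : MonoidAlgebra S W) :
    (repMatrix ρ S z).charpoly.map (φ : S →+* T) =
      (repMatrix ρ T (MonoidAlgebra.mapAlgHom W φ z)).charpoly := by
  rw [← map_repMatrix, ← Matrix.charpoly_map]
  rfl

end RepMatrix

section ExtendScalars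

variable {W ι : Type*} [Group W] [Fintype ι] [DecidableEq ι] (ρ : Representation ℂ W (ι → ℂ))
  {K : Type*} [Field K] [Algebra ℂ K]

theorem toMatrix_asAlgebraHom_extendScalars (z : MonoidAlgebra K W) :
    LinearMap.toMatrix (Algebra.TensorProduct.basis K (Pi.basisFun ℂ ι))
      (Algebra.TensorProduct.basis K (Pi.basisFun ℂ ι))
      ((extendScalars K ρ).asAlgebraHom z) = repMatrix ρ K z := by
  induction z using MonoidAlgebra.induction with
  | zero => simp
  | single_add w a f _ _ ih =>
    have h : extendScalars K ρ w = (ρ w).baseChange K := rfl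
    rw [map_add, map_add, ih, map_add, Representation.asAlgebraHom_single, repMatrix_single,
      map_smul, h, LinearMap.toMatrix_baseChange, LinearMap.toMatrix_eq_toMatrix']

theorem actionCharpoly_extendScalars (B : Subalgebra K (MonoidAlgebra K W)) (z : B) :
    actionCharpoly K z (extendScalars K ρ).asModule =
      (repMatrix ρ K (z : MonoidAlgebra K W)).charpoly := by
  rw [← toMatrix_asAlgebraHom_extendScalars, LinearMap.charpoly_toMatrix]
  rfl

end ExtendScalars

section Specialization

/-- The elements of `k[W]` whose image in `κ[W]` is the reduction of an element of `O[W]`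
belonging to the subalgebra `B` of `K[W]`, for algebras `K ← O → κ` over `k`. -/
def specialization {k O K κ W : Type*} [CommRing k] [CommRing O] [CommRing K] [CommRing κ]
    [Algebra k O] [Algebra k K] [Algebra k κ] [Algebra O K] [IsScalarTower k O K] [Monoid W]
    (π : O →ₐ[k] κ) (B : Subalgebra K (MonoidAlgebra K W)) : Subalgebra k (MonoidAlgebra k W) :=
  (((B.restrictScalars k).comap (MonoidAlgebra.mapAlgHom W (IsScalarTower.toAlgHom k O K))).map
    (MonoidAlgebra.mapAlgHom W π)).comap (MonoidAlgebra.mapAlgHom W (Algebra.ofId k κ))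

variable {W : Type} [Group W] [Finite W] {K : Type} [Field K] [Algebra ℂ K]

theorem cellularCharacter_eq_sum_smul {Q : Type*} [Fintype Q] {A : Subalgebra ℂ (MonoidAlgebra ℂ W)}
    {B : Subalgebra K (MonoidAlgebra K W)} (L : Type) [AddCommGroup L] [Module A L] (S : Q → Type)
    [∀ C, AddCommGroup (S C)] [∀ C, Module B (S C)] (D : Q → ℕ)
    (h : ∀ χ : Irr W, mult A (extendScalars ℂ (irrRep χ)).asModule L =
      ∑ C, mult B (extendScalars K (irrRep χ)).asModule (S C) * D C) :
    cellularCharacter A L = ∑ C, D C • cellularCharacter B (S C) := by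
  have := Fintype.ofFinite (Irr W)
  simp only [cellularCharacter, finsum_eq_sum_of_fintype, Finset.smul_sum, smul_smul, h,
    Finset.sum_smul, mul_comm]
  exact Finset.sum_comm

theorem exists_multiset_sum_eq_sum_smul {Q M : Type*} [Fintype Q] [AddCommMonoid M] (D : Q → ℕ)
    (f : Q → M) : ∃ m : Multiset M, (∀ x ∈ m, x ∈ Set.range f) ∧ ∑ C, D C • f C = m.sum := by
  refine ⟨∑ C, Multiset.replicate (D C) (f C), fun x hx => ?_, ?_⟩
  · obtain ⟨C, -, hC⟩ := Multiset.mem_sum.1 hx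
    exact ⟨C, (Multiset.eq_of_mem_replicate hC).symm⟩
  · rw [← Multiset.coe_sumAddMonoidHom, map_sum]
    simp only [Multiset.coe_sumAddMonoidHom, Multiset.sum_replicate]

open scoped IsMulCommutative in
theorem IsCellularCharacter.exists_multiset_of_le_specialization {O κ : Type*} [CommRing O]
    [IsIntegrallyClosed O] [Algebra O K] [IsFractionRing O K] [Algebra ℂ O] [IsScalarTower ℂ O K]
    [CommRing κ] [IsDomain κ] [Algebra ℂ κ] (π : O →ₐ[ℂ] κ) {A : Subalgebra ℂ (MonoidAlgebra ℂ W)}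
    [IsMulCommutative A] {B : Subalgebra K (MonoidAlgebra K W)} (hAB : A ≤ specialization π B)
    {γ : W → ℂ} (hγ : IsCellularCharacter A γ) :
    ∃ m : Multiset (W → ℂ), (∀ ψ ∈ m, IsCellularCharacter B ψ) ∧ γ = m.sum := by
  obtain ⟨L, _, _, hL, rfl⟩ := hγ
  obtain ⟨a, ha⟩ := exists_mult_eq_rootMultiplicity (k := ℂ) (R := A)
    (fun χ : Irr W => (extendScalars ℂ (irrRep χ)).asModule) L
  obtain ⟨z, hzB, hza⟩ := hAB a.2
  let b : B := ⟨_, hzB⟩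
  let P : Irr W → O[X] := fun χ => (repMatrix (irrRep χ) O z).charpoly
  have hPK : ∀ χ, (P χ).map (algebraMap O K) =
      actionCharpoly K b (extendScalars K (irrRep χ)).asModule := fun χ => by
    rw [actionCharpoly_extendScalars]
    exact charpoly_map_repMatrix (irrRep χ) (IsScalarTower.toAlgHom ℂ O K) z
  have hPκ : ∀ χ, (P χ).map (π : O →+* κ) =
      (actionCharpoly ℂ a (extendScalars ℂ (irrRep χ)).asModule).map (algebraMap ℂ κ) :=
    fun χ => by
      rw [actionCharpoly_extendScalars, charpoly_map_repMatrix]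
      exact (congrArg (fun w => (repMatrix (irrRep χ) κ w).charpoly) hza).trans
        (charpoly_map_repMatrix (irrRep χ) (Algebra.ofId ℂ κ) _).symm
  choose s hb ht using fun χ : Irr W =>
    exists_compositionSeries K B (extendScalars K (irrRep χ)).asModule
  have := Fintype.ofFinite (Quotient (factorSetoid s))
  let D : Quotient (factorSetoid s) → ℕ := fun C =>
    (reduction (π : O →+* κ) (actionCharpoly K b (classFactor s C))).rootMultiplicity 1
  have hmult : ∀ χ : Irr W, mult A (extendScalars ℂ (irrRep χ)).asModule L =
      ∑ C, mult B (extendScalars K (irrRep χ)).asModule (classFactor s C) * D C := fun χ => by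
    rw [← rootMultiplicity_map_eq_sum_mult s hb ht (π : O →+* κ) b χ (P χ) (hPK χ) 1, hPκ,
      ← map_one (algebraMap ℂ κ), ← eq_rootMultiplicity_map (algebraMap ℂ κ).injective, ha]
  obtain ⟨m, hm, hsum⟩ := exists_multiset_sum_eq_sum_smul D
    fun C => cellularCharacter B (classFactor s C)
  refine ⟨m, fun ψ hψ => ?_, (cellularCharacter_eq_sum_smul L _ D hmult).trans hsum⟩
  obtain ⟨C, rfl⟩ := hm ψ hψ
  exact ⟨classFactor s C, inferInstance, inferInstance, isSimpleModule_seriesFactor _ _, rfl⟩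

end Specialization

section WeightValuation

open WithZero

variable {σ k : Type*} [Field k]

/-- The homomorphism `x_i ↦ x_i T ^ (w i)`, along which the degree in `T` restricts to the weighted
degree. -/
def weightHom (w : σ → ℕ) : MvPolynomial σ k →ₐ[k] (FractionRing (MvPolynomial σ k))[X] :=
  MvPolynomial.aeval fun i =>
    C (algebraMap (MvPolynomial σ k) _ (MvPolynomial.X i)) * X ^ w i

theorem weightHom_injective (w : σ → ℕ) : Function.Injective (weightHom (k := k) w) := by
  have h : ((aeval 1).restrictScalars k).comp (weightHom w) =
      IsScalarTower.toAlgHom k (MvPolynomial σ k) (FractionRing (MvPolynomial σ k)) :=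
    MvPolynomial.algHom_ext fun i => by simp [weightHom]
  refine Function.Injective.of_comp
    (f := (aeval (1 : FractionRing (MvPolynomial σ k))).restrictScalars k) ?_
  rw [← AlgHom.coe_comp, h]
  exact IsFractionRing.injective _ _

theorem algebraMap_comp_weightHom_injective (w : σ → ℕ) : Function.Injective
    ((IsScalarTower.toAlgHom k _ (RatFunc (FractionRing (MvPolynomial σ k)))).comp
      (weightHom w)) :=
  (RatFunc.algebraMap_injective _).comp (weightHom_injective w)

open Classical in
/-- The valuation on `k(x_i)` extending the weighted degree in which `x_i` has weight `w i`; it is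
written multiplicatively, so that `x_i` has value `exp (w i)`. -/
def weightValuation (w : σ → ℕ) : Valuation (FractionRing (MvPolynomial σ k)) ℤᵐ⁰ :=
  (RatFunc.inftyValuation (FractionRing (MvPolynomial σ k))).comap
    (IsFractionRing.liftAlgHom (algebraMap_comp_weightHom_injective (k := k) w)).toRingHom

theorem weightValuation_X (w : σ → ℕ) (i : σ) :
    weightValuation (k := k) w (algebraMap (MvPolynomial σ k) _ (MvPolynomial.X i)) =
      exp (w i : ℤ) := by
  classical
  have hX : algebraMap (MvPolynomial σ k) (FractionRing (MvPolynomial σ k)) (.X i) ≠ 0 := by simp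
  rw [weightValuation, Valuation.comap_apply, AlgHom.toRingHom_eq_coe, RingHom.coe_coe,
    IsFractionRing.coe_liftAlgHom,
    IsFractionRing.lift_algebraMap]
  simp [weightHom, RatFunc.inftyValuation.C _ hX, ← exp_nsmul]

instance weightValuation_isTrivialOn (w : σ → ℕ) : (weightValuation (k := k) w).IsTrivialOn k where
  eq_one a ha := by
    classical
    have h : algebraMap k (FractionRing (MvPolynomial σ k)) a ≠ 0 := by simpa using ha
    rw [weightValuation, Valuation.comap_apply, AlgHom.toRingHom_eq_coe, RingHom.coe_coe,
      AlgHom.commutes,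
      IsScalarTower.algebraMap_apply k (FractionRing (MvPolynomial σ k)) (RatFunc _)]
    exact Valuation.IsTrivialOn.eq_one _ h

end WeightValuation

section ValuationRing

variable {k K Γ₀ : Type*} [Field k] [Field K] [Algebra k K] [LinearOrderedCommGroupWithZero Γ₀]
  (v : Valuation K Γ₀) [v.IsTrivialOn k]

instance algebraValuationSubring : Algebra k v.valuationSubring :=
  ((algebraMap k K).codRestrict v.valuationSubring
    (Valuation.IsTrivialOn.valuation_algebraMap_le_one v)).toAlgebra

instance isScalarTower_valuationSubring : IsScalarTower k v.valuationSubring K :=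
  .of_algebraMap_eq fun _ => rfl

theorem exists_residue_eq_of_valuation_sub_lt_one {a : K} {b : k}
    (h : v (a - algebraMap k K b) < 1) :
    ∃ q : v.valuationSubring, (q : K) = a ∧ IsLocalRing.residue v.valuationSubring q =
      algebraMap k (IsLocalRing.ResidueField v.valuationSubring) b := by
  have ha : a ∈ v.valuationSubring := by
    have := v.valuationSubring.add_mem _ _ h.le
      (Valuation.IsTrivialOn.valuation_algebraMap_le_one v b)
    rwa [sub_add_cancel] at this
  refine ⟨⟨a, ha⟩, rfl, sub_eq_zero.1 ?_⟩
  rw [IsScalarTower.algebraMap_apply k v.valuationSubring, IsLocalRing.ResidueField.algebraMap_eq,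
    ← map_sub, IsLocalRing.residue_eq_zero_iff]
  exact (Valuation.mem_maximalIdeal_iff _ _).2 h

end ValuationRing

section LinearForms

/-- The coordinate function `x_i`, as an element of `ℂ(V)`. -/
abbrev coordinate {n : ℕ} (i : Fin n) : RatV n :=
  algebraMap (PolyV n) (RatV n) (MvPolynomial.X i)

/-- A linear form on `V`, as an element of `ℂ(V)`. -/
abbrev linearFormToRat {n : ℕ} (a : Module.Dual ℂ (Fin n → ℂ)) : RatV n :=
  algebraMap (PolyV n) (RatV n) (linearFormToPoly a)

/-- `M` is the last coordinate occurring in the linear form `a`. -/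
def IsLastCoord {n : ℕ} (a : Module.Dual ℂ (Fin n → ℂ)) (M : Fin n) : Prop :=
  a (Pi.single M 1) ≠ 0 ∧ ∀ i, M < i → a (Pi.single i 1) = 0

theorem exists_isLastCoord {n : ℕ} {a : Module.Dual ℂ (Fin n → ℂ)} (ha : a ≠ 0) :
    ∃ M, IsLastCoord a M := by
  obtain ⟨i, hi⟩ : ∃ i, a (Pi.single i 1) ≠ 0 := by
    contrapose! ha
    exact (Pi.basisFun ℂ (Fin n)).ext fun i => by simpa using ha i
  obtain ⟨M, hM⟩ := (Set.toFinite {i | a (Pi.single i 1) ≠ 0}).exists_maximal ⟨i, hi⟩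
  exact ⟨M, hM.prop, fun j hj => not_not.1 fun h => hM.not_gt h hj⟩

variable {n : ℕ} {Γ₀ : Type*} [LinearOrderedCommGroupWithZero Γ₀] (v : Valuation (RatV n) Γ₀)
  [v.IsTrivialOn ℂ] {a : Module.Dual ℂ (Fin n → ℂ)} {M : Fin n}

theorem valuation_linearFormToRat_sub_lt (hv : StrictMono fun i : Fin n => v (coordinate i))
    (hM : IsLastCoord a M) :
    v (linearFormToRat a - algebraMap ℂ (RatV n) (a (Pi.single M 1)) * coordinate M) <
      v (coordinate M) := by
  rw [linearFormToRat, linearFormToPoly, ← Finset.add_sum_erase _ _ (Finset.mem_univ M), map_add,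
    map_mul, ← MvPolynomial.algebraMap_eq, ← IsScalarTower.algebraMap_apply, add_sub_cancel_left,
    map_sum]
  refine v.map_sum_lt (by simp) fun i hi => ?_
  rw [map_mul, ← IsScalarTower.algebraMap_apply, map_mul]
  rcases lt_or_gt_of_ne (Finset.ne_of_mem_erase hi) with h | h
  · exact (mul_le_of_le_one_left' (Valuation.IsTrivialOn.valuation_algebraMap_le_one v _)).trans_lt
      (hv h)
  · rw [hM.2 i h, map_zero, map_zero, zero_mul]
    exact zero_lt_iff.2 (by simp)

theorem valuation_linearFormToRat (hv : StrictMono fun i : Fin n => v (coordinate i))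
    (hM : IsLastCoord a M) : v (linearFormToRat a) = v (coordinate M) := by
  have h : v (algebraMap ℂ (RatV n) (a (Pi.single M 1)) * coordinate M) = v (coordinate M) := by
    rw [map_mul, Valuation.IsTrivialOn.eq_one _ hM.1, one_mul]
  rw [← h]
  exact v.map_eq_of_sub_lt (h.symm ▸ valuation_linearFormToRat_sub_lt v hv hM)

theorem valuation_coordinate_mul_div_sub_lt_one
    (hv : StrictMono fun i : Fin n => v (coordinate i)) (hM : IsLastCoord a M) (b : ℂ)
    (k : Fin n) :
    v (coordinate k * (algebraMap (PolyV n) (RatV n) (MvPolynomial.C (b * a (Pi.single k 1))) /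
      linearFormToRat a) - algebraMap ℂ (RatV n) (if k = M then b else 0)) < 1 := by
  have hval := valuation_linearFormToRat v hv hM
  have hpos : 0 < v (coordinate M) := zero_lt_iff.2 (by simp)
  have h0 : linearFormToRat a ≠ 0 := fun h => by
    rw [h, map_zero] at hval
    exact hpos.ne hval
  have hle := Valuation.IsTrivialOn.valuation_algebraMap_le_one (A := ℂ) v
  rw [← MvPolynomial.algebraMap_eq, ← IsScalarTower.algebraMap_apply]
  rcases lt_trichotomy k M with h | rfl | h
  · rw [if_neg h.ne, map_zero, sub_zero, map_mul, map_div₀, hval, mul_div_assoc', div_lt_one₀ hpos]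
    exact (mul_le_of_le_one_right' (hle _)).trans_lt (hv h)
  · have e : coordinate k * (algebraMap ℂ (RatV n) (b * a (Pi.single k 1)) / linearFormToRat a) -
        algebraMap ℂ (RatV n) b = algebraMap ℂ (RatV n) (-b) * ((linearFormToRat a -
        algebraMap ℂ (RatV n) (a (Pi.single k 1)) * coordinate k) / linearFormToRat a) := by
      rw [map_mul, map_neg]
      field_simp
      ring
    rw [if_pos rfl, e, map_mul]
    refine (mul_le_of_le_one_left' (hle _)).trans_lt ?_
    rw [map_div₀, hval, div_lt_one₀ hpos]
    exact valuation_linearFormToRat_sub_lt v hv hM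
  · simp [if_neg h.ne', hM.2 k h]

end LinearForms

section Flags

variable {n : ℕ} {W : Subgroup (GL (Fin n) ℂ)}

theorem toMatrix_inv_mul_self (w : W) : toMatrix w⁻¹ * toMatrix w = 1 := by
  change toMatrix (w⁻¹ * w) = 1
  rw [inv_mul_cancel]
  rfl

/-- The subgroup `W_k` of `W` fixing the basis vectors `y_{k+1}, …, y_n`; for `W = G(d,1,n)` it
is `G(d,1,k)`. -/
def flagStabilizer (W : Subgroup (GL (Fin n) ℂ)) (k : ℕ) : Subgroup W where
  carrier := {w | ∀ j : Fin n, k ≤ (j : ℕ) → (toMatrix w).mulVec (Pi.single j 1) = Pi.single j 1}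
  one_mem' _ _ := Matrix.one_mulVec _
  mul_mem' {v w} hv hw j hj := by
    rw [show toMatrix (v * w) = toMatrix v * toMatrix w from rfl, ← Matrix.mulVec_mulVec, hw j hj,
      hv j hj]
  inv_mem' {w} hw j hj := by
    conv_lhs => rw [← hw j hj, Matrix.mulVec_mulVec, toMatrix_inv_mul_self, Matrix.one_mulVec]

theorem flagStabilizer_mono {j k : ℕ} (h : j ≤ k) : flagStabilizer W j ≤ flagStabilizer W k :=
  fun _ hw i hi => hw i (h.trans hi)

/-- The Euler element `∑_{s ∈ Ref(W_k)} c_s det(s) s` of `W_k`, in the group algebra of `W`. -/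
def flagEuler (c : Ref W → ℂ) (k : ℕ) : MonoidAlgebra ℂ W :=
  ∑ᶠ (s : Ref W) (_ : (s : W) ∈ flagStabilizer W k),
    MonoidAlgebra.single (s : W) (c s * (toMatrix s.1).det)

/-- The Jucys–Murphy elements of the chain of subgroups `W_0 ≤ W_1 ≤ …`. As for `jucysMurphy`,
the index starts at `0`. -/
def flagJucysMurphy (c : Ref W → ℂ) (k : Fin n) : MonoidAlgebra ℂ W :=
  flagEuler c ((k : ℕ) + 1) - flagEuler c (k : ℕ)

/-- The subalgebra of `ℂW` generated by the Jucys–Murphy elements. -/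
def flagJMAlgebra (c : Ref W → ℂ) : Subalgebra ℂ (MonoidAlgebra ℂ W) :=
  Algebra.adjoin ℂ (Set.range (flagJucysMurphy c))

open Classical in
theorem flagEuler_eq_sum [Fintype (Ref W)] (c : Ref W → ℂ) (k : ℕ) :
    flagEuler c k = ∑ s : Ref W, MonoidAlgebra.single (s : W)
      (if (s : W) ∈ flagStabilizer W k then c s * (toMatrix s.1).det else 0) := by
  rw [flagEuler, finsum_eq_sum_of_fintype]
  refine Finset.sum_congr rfl fun s _ => finsum_eq_if.trans ?_
  split_ifs
  · rfl
  · exact (MonoidAlgebra.single_zero _).symm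

end Flags

section Commutation

theorem commute_single_sum_single {k W I : Type*} [CommSemiring k] [Monoid W] [Fintype I]
    (e : I ≃ I) (g : I → W) (f : I → k) {w : W} (hg : ∀ i, g (e i) * w = w * g i)
    (hf : ∀ i, f (e i) = f i) (a : k) :
    Commute (MonoidAlgebra.single w a) (∑ i, MonoidAlgebra.single (g i) (f i)) := by
  rw [commute_iff_eq, Finset.mul_sum, Finset.sum_mul,
    ← Equiv.sum_comp e fun i => MonoidAlgebra.single (g i) (f i) * MonoidAlgebra.single w a]
  refine Finset.sum_congr rfl fun i _ => ?_
  rw [MonoidAlgebra.single_mul_single, MonoidAlgebra.single_mul_single, hg, hf, mul_comm a]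

variable {n : ℕ} {W : Subgroup (GL (Fin n) ℂ)}

theorem isUnit_det_toMatrix (w : W) : IsUnit (toMatrix w).det :=
  (Matrix.isUnit_iff_isUnit_det _).1 (w : GL (Fin n) ℂ).isUnit

theorem conj_mem_Ref (w : W) {s : W} (hs : s ∈ Ref W) : w * s * w⁻¹ ∈ Ref W := by
  have h : toMatrix (w * s * w⁻¹) - 1 = toMatrix w * (toMatrix s - 1) * toMatrix w⁻¹ := by
    have hinv : toMatrix w * toMatrix w⁻¹ = 1 := by simpa using toMatrix_inv_mul_self w⁻¹
    rw [mul_sub, sub_mul, mul_one, hinv]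
    rfl
  rw [Ref, Set.mem_ofPred_eq, h, Matrix.rank_mul_eq_left_of_isUnit_det _ _ (isUnit_det_toMatrix _),
    Matrix.rank_mul_eq_right_of_isUnit_det _ _ (isUnit_det_toMatrix _)]
  exact hs

/-- Conjugation by `w`, as a permutation of the reflections. -/
def conjRef (w : W) : Ref W ≃ Ref W where
  toFun s := ⟨w * s.1 * w⁻¹, conj_mem_Ref w s.2⟩
  invFun s := ⟨w⁻¹ * s.1 * w, by simpa using conj_mem_Ref w⁻¹ s.2⟩
  left_inv s := Subtype.ext (by group)
  right_inv s := Subtype.ext (by group)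

variable [Finite W] {c : Ref W → ℂ} (hc : IsConjInvariant c)
include hc

theorem commute_single_flagEuler {k : ℕ} {w : W} (hw : w ∈ flagStabilizer W k) (a : ℂ) :
    Commute (MonoidAlgebra.single w a) (flagEuler c k) := by
  classical
  have := Fintype.ofFinite (Ref W)
  rw [flagEuler_eq_sum]
  refine commute_single_sum_single (conjRef w) _ _ (fun s => by simp [conjRef]) (fun s => ?_) a
  have hcs : c (conjRef w s) = c s := hc _ _ (isConj_iff.2 ⟨w⁻¹, by simp [conjRef, mul_assoc]⟩)
  have hdet : (toMatrix (conjRef w s).1).det = (toMatrix s.1).det :=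
    Matrix.det_units_conj (w : GL (Fin n) ℂ) (toMatrix s.1)
  have hmem : (conjRef w s : W) ∈ flagStabilizer W k ↔ (s : W) ∈ flagStabilizer W k :=
    (Subgroup.mul_mem_cancel_right _ (inv_mem hw)).trans (Subgroup.mul_mem_cancel_left _ hw)
  rw [hcs, hdet, if_congr hmem rfl rfl]

theorem commute_flagEuler (j k : ℕ) : Commute (flagEuler c j) (flagEuler c k) := by
  classical
  wlog h : j ≤ k generalizing j k
  · exact (this k j (le_of_not_ge h)).symm
  have := Fintype.ofFinite (Ref W)
  rw [flagEuler_eq_sum c j]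
  refine Commute.sum_left _ _ _ fun s _ => ?_
  split_ifs with hs
  · exact commute_single_flagEuler hc (flagStabilizer_mono h hs) _
  · rw [MonoidAlgebra.single_zero]
    exact Commute.zero_left _

theorem isMulCommutative_flagJMAlgebra : IsMulCommutative (flagJMAlgebra c) := by
  refine Algebra.isMulCommutative_adjoin ℂ ?_
  rintro _ ⟨j, rfl⟩ _ ⟨k, rfl⟩
  have h := commute_flagEuler hc
  exact (((h _ _).sub_left (h _ _)).sub_right ((h _ _).sub_left (h _ _))).eq

end Commutation

section JucysMurphy

variable {n : ℕ} {W : Subgroup (GL (Fin n) ℂ)} {α : Ref W → Module.Dual ℂ (Fin n → ℂ)}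

theorem IsRootChoice.apply_eq_zero_iff (hα : IsRootChoice W α) (s : Ref W) (v : Fin n → ℂ) :
    α s v = 0 ↔ (toMatrix s.1).mulVec v = v := by
  rw [← LinearMap.mem_ker, hα s, LinearMap.mem_ker, Matrix.mulVecLin_apply, Matrix.sub_mulVec,
    Matrix.one_mulVec, sub_eq_zero]

theorem IsRootChoice.ne_zero (hα : IsRootChoice W α) (s : Ref W) : α s ≠ 0 := by
  intro h
  have hone : toMatrix s.1 = 1 := Matrix.ext_of_mulVec_single fun i => by
    rw [(hα.apply_eq_zero_iff s _).1 (by rw [h, LinearMap.zero_apply]), Matrix.one_mulVec]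
  have hrank : (toMatrix s.1 - 1).rank = 1 := s.2
  rw [hone, sub_self, Matrix.rank_zero] at hrank
  exact zero_ne_one hrank

theorem IsRootChoice.mem_flagStabilizer_iff_lt (hα : IsRootChoice W α) {s : Ref W} {M : Fin n}
    (hM : IsLastCoord (α s) M) (k : ℕ) : (s : W) ∈ flagStabilizer W k ↔ (M : ℕ) < k := by
  refine ⟨fun h => ?_, fun h j hj => ?_⟩
  · by_contra hk
    exact hM.1 ((hα.apply_eq_zero_iff s _).2 (h M (not_lt.1 hk)))
  · exact (hα.apply_eq_zero_iff s _).1 (hM.2 j (Fin.lt_def.2 (h.trans_le hj)))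

theorem flagJucysMurphy_eq_sum [Fintype (Ref W)] (hα : IsRootChoice W α) (c : Ref W → ℂ)
    {M : Ref W → Fin n} (hM : ∀ s, IsLastCoord (α s) (M s)) (k : Fin n) :
    flagJucysMurphy c k = ∑ s : Ref W, MonoidAlgebra.single (s : W)
      (if k = M s then c s * (toMatrix s.1).det else 0) := by
  classical
  rw [flagJucysMurphy, flagEuler_eq_sum, flagEuler_eq_sum, ← Finset.sum_sub_distrib]
  refine Finset.sum_congr rfl fun s _ => ?_
  rw [← MonoidAlgebra.single_sub]
  congr 1
  simp only [hα.mem_flagStabilizer_iff_lt (hM s), Fin.ext_iff]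
  split_ifs <;> first | omega | simp

theorem gaudinOperator_mem_gaudinAlgebraRat (c : Ref W → ℂ)
    (α : Ref W → Module.Dual ℂ (Fin n → ℂ)) (y : Fin n → ℂ) :
    gaudinOperator W c α y ∈ gaudinAlgebraRat W c α :=
  Algebra.subset_adjoin (Algebra.subset_adjoin ⟨y, rfl⟩)

variable [Finite W] {Γ₀ : Type*} [LinearOrderedCommGroupWithZero Γ₀] (v : Valuation (RatV n) Γ₀)
  [v.IsTrivialOn ℂ] (hv : StrictMono fun i : Fin n => v (coordinate i)) (hα : IsRootChoice W α)
include hv hα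

theorem flagJucysMurphy_mem_specialization (c : Ref W → ℂ) (k : Fin n) :
    flagJucysMurphy c k ∈ specialization (IsScalarTower.toAlgHom ℂ v.valuationSubring
      (IsLocalRing.ResidueField v.valuationSubring)) (gaudinAlgebraRat W c α) := by
  have := Fintype.ofFinite (Ref W)
  choose M hM using fun s => exists_isLastCoord (hα.ne_zero s)
  choose q hq hres using fun s => exists_residue_eq_of_valuation_sub_lt_one v
    (valuation_coordinate_mul_div_sub_lt_one v hv (hM s) (c s * (toMatrix s.1).det) k)
  refine ⟨∑ s : Ref W, MonoidAlgebra.single (s : W) (q s), ?_, ?_⟩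
  · have hlift : MonoidAlgebra.mapAlgHom W (IsScalarTower.toAlgHom ℂ v.valuationSubring (RatV n))
        (∑ s : Ref W, MonoidAlgebra.single (s : W) (q s)) =
          coordinate k • gaudinOperator W c α (Pi.single k 1) := by
      rw [gaudinOperator, finsum_eq_sum_of_fintype, Finset.smul_sum, map_sum]
      refine Finset.sum_congr rfl fun s _ => ?_
      rw [MonoidAlgebra.mapAlgHom_single, MonoidAlgebra.smul_single, smul_eq_mul]
      exact congrArg _ (hq s)
    change MonoidAlgebra.mapAlgHom W _ _ ∈ gaudinAlgebraRat W c α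
    rw [hlift]
    exact Subalgebra.smul_mem _ (gaudinOperator_mem_gaudinAlgebraRat c α _) _
  · rw [flagJucysMurphy_eq_sum hα c hM]
    simp only [RingHom.coe_coe, map_sum, MonoidAlgebra.mapAlgHom_single]
    exact Finset.sum_congr rfl fun s _ => congrArg _ (hres s)

theorem flagJMAlgebra_le_specialization (c : Ref W → ℂ) :
    flagJMAlgebra c ≤ specialization (IsScalarTower.toAlgHom ℂ v.valuationSubring
      (IsLocalRing.ResidueField v.valuationSubring)) (gaudinAlgebraRat W c α) := by
  refine Algebra.adjoin_le ?_
  rintro _ ⟨k, rfl⟩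
  exact flagJucysMurphy_mem_specialization v hv hα c k

end JucysMurphy

end CalogeroMoser

end

theorem mainTheorem4_general {n : ℕ} (W : Subgroup (GL (Fin n) ℂ)) [Finite W]
    (c : CalogeroMoser.Ref W → ℂ) (hc : CalogeroMoser.IsConjInvariant c)
    (α : CalogeroMoser.Ref W → Module.Dual ℂ (Fin n → ℂ)) (hα : CalogeroMoser.IsRootChoice W α)
    (γ : W → ℂ) (hγ : CalogeroMoser.IsCellularCharacter (CalogeroMoser.flagJMAlgebra c) γ) :
    ∃ m : Multiset (W → ℂ),
      (∀ ψ ∈ m, CalogeroMoser.IsCMCellularCharacter W c α ψ) ∧ γ = m.sum := by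
  let v := CalogeroMoser.weightValuation (k := ℂ) (Fin.val : Fin n → ℕ)
  have hv : StrictMono fun i : Fin n => v (CalogeroMoser.coordinate i) := fun i j hij => by
    simpa only [v, CalogeroMoser.coordinate, CalogeroMoser.weightValuation_X, WithZero.exp_lt_exp,
      Nat.cast_lt, Fin.val_fin_lt] using hij
  have := CalogeroMoser.isMulCommutative_flagJMAlgebra hc
  exact hγ.exists_multiset_of_le_specialization _
    (CalogeroMoser.flagJMAlgebra_le_specialization v hv hα c)

theorem mainTheorem4 (d n : ℕ) (hd : 0 < d)
    (c : CalogeroMoser.Ref (CalogeroMoser.G d n) → ℂ)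
    (hc : CalogeroMoser.IsConjInvariant c)
    (α : CalogeroMoser.Ref (CalogeroMoser.G d n) → Module.Dual ℂ (Fin n → ℂ))
    (hα : CalogeroMoser.IsRootChoice (CalogeroMoser.G d n) α)
    (γ : CalogeroMoser.G d n → ℂ)
    (hγ : CalogeroMoser.IsCellularCharacter (CalogeroMoser.jmAlgebra c) γ) :
    ∃ m : Multiset (CalogeroMoser.G d n → ℂ),
      (∀ ψ ∈ m, CalogeroMoser.IsCMCellularCharacter (CalogeroMoser.G d n) c α ψ) ∧
        γ = m.sum := by
  have := CalogeroMoser.G_finite d n hd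
  exact mainTheorem4_general (CalogeroMoser.G d n) c hc α hα γ hγ
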